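/- A tournament is a finite loopless directed graph with exactly one arc between every pair of distinct vertices. A feedback vertex set of a tournament $T$ with vertex set $V$ is a set $F \subseteq V$ such that the subtournament $T[V \setminus F]$ induced by $V \setminus F$ has no directed cycle; it is minimal if no proper subset of $F$ is a feedback vertex set of $T$. Let $M(n)$ denote the maximum number of minimal feedback vertex sets of a tournament, taken over all tournaments on $n$ vertices. Then the limit $\lim_{n\to\infty} M(n)^{1/n}$ exists, and $$1.5448 \;\le\; \lim_{n\to\infty} M(n)^{1/n} \;\le\; 1.6740.$$ -/

import Mathlib

open Filter Topology

namespace Digraph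

/-- A tournament: no loops, and exactly one arc between any two distinct vertices. -/
def IsTournament {V : Type*} (T : Digraph V) : Prop :=
  (∀ v, ¬ T.Adj v v) ∧ ∀ u v, u ≠ v → Xor (T.Adj u v) (T.Adj v u)

/-- The subdigraph `T[S]` induced by a set `S` of vertices. -/
def inducedOn {V : Type*} (T : Digraph V) (S : Set V) : Digraph S where
  Adj u v := T.Adj u v

/-- There is no directed cycle: no vertex can be reached from itself by a directed walk with at
least one arc (a shortest such closed walk is a directed cycle). -/
def Acyclic {V : Type*} (T : Digraph V) : Prop :=
  ∀ v, ¬ Relation.TransGen T.Adj v v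

/-- `F` is a feedback vertex set of `T`: the digraph `T[V \ F]` is acyclic. -/
def IsFVS {V : Type*} (T : Digraph V) (F : Set V) : Prop :=
  (T.inducedOn Fᶜ).Acyclic

/-- The collection of the feedback vertex sets that are minimal under inclusion. -/
def minimalFVS {V : Type*} (T : Digraph V) : Set (Set V) :=
  {F | Minimal T.IsFVS F}

/-- `f(T)`, the number of minimal feedback vertex sets of `T`. -/
noncomputable def numMinimalFVS {V : Type*} (T : Digraph V) : ℕ :=
  T.minimalFVS.ncard

end Digraph

/-- `M(n)`, the maximum of `f(T)` over all tournaments `T` on `n` vertices. -/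
noncomputable def maxMinimalFVS (n : ℕ) : ℕ :=
  sSup {k | ∃ T : Digraph (Fin n), T.IsTournament ∧ T.numMinimalFVS = k}

/-- The supremum in the definition of `M(n)` is attained, so it is a maximum. -/
theorem isGreatest_maxMinimalFVS (n : ℕ) :
    IsGreatest {k | ∃ T : Digraph (Fin n), T.IsTournament ∧ T.numMinimalFVS = k}
      (maxMinimalFVS n) := by
  have hb : BddAbove {k | ∃ T : Digraph (Fin n), T.IsTournament ∧ T.numMinimalFVS = k} := by
    refine ⟨(Set.univ : Set (Set (Fin n))).ncard, ?_⟩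
    rintro k ⟨T, -, rfl⟩
    exact Set.ncard_le_ncard (Set.subset_univ _) Set.finite_univ
  have hne : {k | ∃ T : Digraph (Fin n), T.IsTournament ∧ T.numMinimalFVS = k}.Nonempty := by
    refine ⟨_, ⟨fun u v => u < v⟩, ⟨fun v => lt_irrefl v, fun u v huv => ?_⟩, rfl⟩
    rcases lt_or_gt_of_ne huv with h | h
    · exact Or.inl ⟨h, h.not_gt⟩
    · exact Or.inr ⟨h, h.not_gt⟩
  exact ⟨Nat.sSup_mem hne hb, fun k hk => le_csSup hb hk⟩

/-! A tournament is acyclic exactly when its arc relation is transitive, so complementation turns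
minimal feedback vertex sets into maximal transitive vertex sets.

Upper bound: induction on the size of `S`. If `u ∈ W` and `A` is the set of in-neighbours of `u` in
`W`, then `A ∪ {u}` dominates the rest of `W`, and that rest is a maximal transitive subset of the
set of dominated vertices (`cnt_le_card_of_prefix`). A class of sets `W` whose remainders live on at
most `|S| - k` vertices thus has weight at most `x ^ k` relative to `1.674 ^ |S|`, where `x =
500/837`. It remains to split all `W` into classes of total weight at most 1. If some `v` has at
most two in-neighbours, the split follows `v`, its in-neighbours and, where needed, theirs; a
maximal `W` omitting `v` must contain two vertices forming a triangle with `v`, which limits the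
cases. If all in-degrees are at least 3, the split is by the source of `W`, and the weight `∑ x ^
(d(v) + 1)` is bounded through Landau's inequality (`sum_pow_le_of_landau`).

Lower bound: ordered sums make `M` supermultiplicative, so by Fekete's lemma the limit is at least
`M(7) ^ (1/7)`, and the Paley tournament on seven vertices gives `M(7) ≥ 21`. -/

namespace Digraph

/-! ### Maximal transitive sets and the counting tools -/

open scoped Classical

variable {V : Type*} {T : Digraph V}

/-- The arcs between vertices of `W` form a transitive relation. -/
def IsTransOn (T : Digraph V) (W : Finset V) : Prop :=
  ∀ a ∈ W, ∀ b ∈ W, ∀ c ∈ W, T.Adj a b → T.Adj b c → T.Adj a c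

/-- The maximal transitive subsets of `S`. -/
noncomputable def maxTrans (T : Digraph V) (S : Finset V) : Finset (Finset V) :=
  S.powerset.filter fun W => T.IsTransOn W ∧ ∀ x ∈ S, T.IsTransOn (insert x W) → x ∈ W

/-- The number of maximal transitive subsets of `S` satisfying `p`. -/
noncomputable def cnt (T : Digraph V) (S : Finset V) (p : Finset V → Prop) : ℝ :=
  (((T.maxTrans S).filter p).card : ℝ)

/-- In-neighbours of `u` within `S`. -/
noncomputable def inN (T : Digraph V) (S : Finset V) (u : V) : Finset V :=
  S.filter fun x => T.Adj x u

/-- Out-neighbours of `u` within `S`. -/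
noncomputable def outN (T : Digraph V) (S : Finset V) (u : V) : Finset V :=
  S.filter fun x => T.Adj u x

/-- The vertices of `S` outside `X` dominated by `u` and by all of `A`. -/
noncomputable def domBy (T : Digraph V) (S : Finset V) (u : V) (A X : Finset V) : Finset V :=
  S.filter fun d => d ∉ X ∧ T.Adj u d ∧ ∀ a ∈ A, T.Adj a d

theorem IsTournament.irrefl (hT : T.IsTournament) (v : V) : ¬ T.Adj v v := hT.1 v

theorem IsTournament.asymm (hT : T.IsTournament) {u v : V} (h : T.Adj u v) : ¬ T.Adj v u := by
  intro h'
  by_cases huv : u = v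
  · subst huv; exact hT.1 _ h
  · rcases hT.2 u v huv with ⟨_, h2⟩ | ⟨_, h2⟩ <;> contradiction

theorem IsTournament.total (hT : T.IsTournament) {u v : V} (h : u ≠ v) :
    T.Adj u v ∨ T.Adj v u := by
  rcases hT.2 u v h with ⟨h1, _⟩ | ⟨h1, _⟩
  · exact Or.inl h1
  · exact Or.inr h1

theorem IsTransOn.mono {W W' : Finset V} (h : T.IsTransOn W) (hs : W' ⊆ W) : T.IsTransOn W' :=
  fun a ha b hb c hc => h a (hs ha) b (hs hb) c (hs hc)

theorem mem_maxTrans {S W : Finset V} : W ∈ T.maxTrans S ↔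
    W ⊆ S ∧ T.IsTransOn W ∧ ∀ x ∈ S, T.IsTransOn (insert x W) → x ∈ W := by
  unfold maxTrans
  rw [Finset.mem_filter, Finset.mem_powerset]

theorem mem_inN {S : Finset V} {u x : V} : x ∈ T.inN S u ↔ x ∈ S ∧ T.Adj x u := by
  simp [inN]

theorem mem_outN {S : Finset V} {u x : V} : x ∈ T.outN S u ↔ x ∈ S ∧ T.Adj u x := by
  simp [outN]

theorem mem_domBy {S : Finset V} {u d : V} {A X : Finset V} : d ∈ T.domBy S u A X ↔
    d ∈ S ∧ d ∉ X ∧ T.Adj u d ∧ ∀ a ∈ A, T.Adj a d := by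
  simp [domBy]

theorem IsTransOn.union (hT : T.IsTournament) {P D : Finset V} (hP : T.IsTransOn P)
    (hD : T.IsTransOn D) (h : ∀ p ∈ P, ∀ d ∈ D, T.Adj p d) : T.IsTransOn (P ∪ D) := by
  intro a ha b hb c hc hab hbc
  simp only [Finset.mem_union] at ha hb hc
  have key : ∀ p ∈ P, ∀ d ∈ D, ¬ T.Adj d p := fun p hp d hd => hT.asymm (h p hp d hd)
  rcases ha with ha | ha <;> rcases hb with hb | hb <;> rcases hc with hc | hc
  · exact hP a ha b hb c hc hab hbc
  · exact h a ha c hc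
  · exact absurd hbc (key c hc b hb)
  · exact h a ha c hc
  · exact absurd hab (key b hb a ha)
  · exact absurd hab (key b hb a ha)
  · exact absurd hbc (key c hc b hb)
  · exact hD a ha b hb c hc hab hbc

/-- Removing a common initial segment `P` that dominates `D` maps maximal transitive sets of `S`
injectively to maximal transitive sets of `D`. -/
theorem cnt_le_card_of_prefix (hT : T.IsTournament) {S P D : Finset V} {p : Finset V → Prop}
    (hDS : D ⊆ S) (hPD : ∀ a ∈ P, ∀ d ∈ D, T.Adj a d)
    (hp : ∀ W ∈ T.maxTrans S, p W → P ⊆ W ∧ W \ P ⊆ D) :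
    T.cnt S p ≤ ((T.maxTrans D).card : ℝ) := by
  unfold cnt
  rw [Nat.cast_le]
  refine Finset.card_le_card_of_injOn (fun W => W \ P) ?_ ?_
  · intro W hW
    simp only [Finset.coe_filter, Set.mem_ofPred_eq] at hW
    obtain ⟨hPW, hWD⟩ := hp W hW.1 hW.2
    obtain ⟨hWS, htr, hmax⟩ := mem_maxTrans.1 hW.1
    refine mem_maxTrans.2 ⟨hWD, htr.mono Finset.sdiff_subset, fun x hx hxt => ?_⟩
    have hxP : x ∉ P := fun h => hT.irrefl x (hPD x h x hx)
    refine Finset.mem_sdiff.2 ⟨hmax x (hDS hx) ?_, hxP⟩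
    -- Since `P` dominates `D`, an extension of the remainder inside `D` stays transitive after `P`
    -- is put back, so maximality of `W` applies.
    have h2 := IsTransOn.union hT (htr.mono hPW) hxt (fun a ha d hd => by
      rcases Finset.mem_insert.1 hd with rfl | hd
      · exact hPD a ha _ hx
      · exact hPD a ha d (hWD hd))
    refine h2.mono ?_
    intro y hy
    rcases Finset.mem_insert.1 hy with rfl | hy
    · simp
    · by_cases hyP : y ∈ P
      · simp [hyP]
      · simp [hyP, hy]
  · intro W hW W' hW' h
    simp only [Finset.coe_filter, Set.mem_ofPred_eq] at hW hW'
    have h1 := (hp W hW.1 hW.2).1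
    have h2 := (hp W' hW'.1 hW'.2).1
    have h : W \ P = W' \ P := h
    rw [← Finset.sdiff_union_of_subset h1, h, Finset.sdiff_union_of_subset h2]

theorem cnt_le_card_domBy (hT : T.IsTournament) {S : Finset V} {p : Finset V → Prop} (u : V)
    (A X : Finset V)
    (hp : ∀ W ∈ T.maxTrans S, p W → u ∈ W ∧ W ∩ T.inN S u = A ∧ Disjoint W X) :
    T.cnt S p ≤ ((T.maxTrans (T.domBy S u A X)).card : ℝ) := by
  refine cnt_le_card_of_prefix hT (P := insert u A) ?_ ?_ ?_
  · intro d hd; exact (mem_domBy.1 hd).1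
  · intro a ha d hd
    obtain ⟨_, _, h1, h2⟩ := mem_domBy.1 hd
    rcases Finset.mem_insert.1 ha with rfl | ha
    · exact h1
    · exact h2 a ha
  · intro W hW hpW
    obtain ⟨huW, rfl, hX⟩ := hp W hW hpW
    obtain ⟨hWS, htr, -⟩ := mem_maxTrans.1 hW
    refine ⟨Finset.insert_subset huW Finset.inter_subset_left, fun d hd => ?_⟩
    simp only [Finset.mem_sdiff, Finset.mem_insert, Finset.mem_inter, mem_inN, not_or, not_and] at hd
    obtain ⟨hdW, hdu, hd2⟩ := hd
    have hud : T.Adj u d := (hT.total hdu).resolve_left (hd2 hdW (hWS hdW))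
    refine mem_domBy.2 ⟨hWS hdW, Finset.disjoint_left.1 hX hdW, hud, fun a ha => ?_⟩
    simp only [Finset.mem_inter, mem_inN] at ha
    exact htr a ha.1 u huW d hdW ha.2.2 hud

theorem cnt_le_card_of_disjoint (hT : T.IsTournament) {S : Finset V} {p : Finset V → Prop}
    (X : Finset V) (hp : ∀ W ∈ T.maxTrans S, p W → Disjoint W X) :
    T.cnt S p ≤ ((T.maxTrans (S \ X)).card : ℝ) := by
  refine cnt_le_card_of_prefix hT (P := ∅) Finset.sdiff_subset (by simp) fun W hW hpW => ?_
  refine ⟨by simp, fun d hd => ?_⟩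
  have hdW : d ∈ W := by simpa using hd
  exact Finset.mem_sdiff.2 ⟨(mem_maxTrans.1 hW).1 hdW, Finset.disjoint_left.1 (hp W hW hpW) hdW⟩

theorem cnt_le_add {S : Finset V} {p q r : Finset V → Prop}
    (h : ∀ W ∈ T.maxTrans S, p W → q W ∨ r W) : T.cnt S p ≤ T.cnt S q + T.cnt S r := by
  unfold cnt
  rw [← Nat.cast_add, Nat.cast_le]
  refine le_trans (Finset.card_le_card ?_) (Finset.card_union_le _ _)
  intro W hW
  simp only [Finset.mem_filter, Finset.mem_union] at hW ⊢
  rcases h W hW.1 hW.2 with h | h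
  · exact Or.inl ⟨hW.1, h⟩
  · exact Or.inr ⟨hW.1, h⟩

theorem cnt_le_sum {ι : Type*} {S : Finset V} {p : Finset V → Prop} (I : Finset ι)
    (q : ι → Finset V → Prop) (h : ∀ W ∈ T.maxTrans S, p W → ∃ i ∈ I, q i W) :
    T.cnt S p ≤ ∑ i ∈ I, T.cnt S (q i) := by
  unfold cnt
  rw [← Nat.cast_sum, Nat.cast_le]
  refine le_trans (Finset.card_le_card ?_)
    (Finset.card_biUnion_le (s := I) (t := fun i => (T.maxTrans S).filter (q i)))
  intro W hW
  simp only [Finset.mem_filter, Finset.mem_biUnion] at hW ⊢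
  obtain ⟨i, hi, hq⟩ := h W hW.1 hW.2
  exact ⟨i, hi, hW.1, hq⟩

theorem cnt_le_card_mul {ι : Type*} {S : Finset V} {p : Finset V → Prop} (I : Finset ι)
    (q : ι → Finset V → Prop) (b : ℝ) (h : ∀ W ∈ T.maxTrans S, p W → ∃ i ∈ I, q i W)
    (hb : ∀ i ∈ I, T.cnt S (q i) ≤ b) :
    T.cnt S p ≤ I.card * b := by
  refine (cnt_le_sum I q h).trans ?_
  rw [← nsmul_eq_mul]
  exact Finset.sum_le_card_nsmul _ _ _ hb

theorem cnt_true {S : Finset V} : T.cnt S (fun _ => True) = (T.maxTrans S).card := by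
  simp [cnt]

theorem cnt_eq_zero {S : Finset V} {p : Finset V → Prop} (h : ∀ W ∈ T.maxTrans S, ¬ p W) :
    T.cnt S p = 0 := by
  unfold cnt
  rw [Finset.filter_eq_empty_iff.2 (fun W hW => h W hW)]
  simp

/-- A vertex outside a maximal transitive set lies on a triangle with two of its members. -/
theorem exists_triangle_of_notMem (hT : T.IsTournament) {S W : Finset V} (hW : W ∈ T.maxTrans S)
    {v : V} (hv : v ∈ S) (hvW : v ∉ W) :
    ∃ a ∈ W, ∃ b ∈ W, T.Adj a v ∧ T.Adj v b ∧ T.Adj b a := by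
  obtain ⟨hWS, htr, hmax⟩ := mem_maxTrans.1 hW
  by_contra! hcon
  have tot : ∀ a ∈ W, ∀ b ∈ W, T.Adj a v → T.Adj v b → T.Adj a b := fun a ha b hb h1 h2 =>
    (hT.total (fun h : a = b => hT.asymm h1 (h ▸ h2))).resolve_right (hcon a ha b hb h1 h2)
  refine hvW (hmax v hv fun a ha b hb c hc hab hbc => ?_)
  simp only [Finset.mem_insert] at ha hb hc
  rcases ha with rfl | ha <;> rcases hb with rfl | hb <;> rcases hc with rfl | hc
  · exact absurd hab (hT.irrefl _)
  · exact absurd hab (hT.irrefl _)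
  · exact absurd hbc (hT.asymm hab)
  · have hne : a ≠ c := fun h => hvW (h ▸ hc)
    refine (hT.total hne).resolve_right fun h => ?_
    exact hcon c hc b hb h hab hbc
  · exact absurd hbc (hT.irrefl _)
  · exact tot a ha c hc hab hbc
  · have hne : a ≠ c := fun h => hvW (h ▸ ha)
    refine (hT.total hne).resolve_right fun h => ?_
    exact hcon b hb a ha hbc h hab
  · exact htr a ha b hb c hc hab hbc

theorem card_inN_add_card_outN (hT : T.IsTournament) {S : Finset V} {u : V} (hu : u ∈ S) :
    (T.inN S u).card + (T.outN S u).card + 1 = S.card := by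
  have hd : Disjoint (T.inN S u) (T.outN S u) := by
    rw [Finset.disjoint_left]
    intro x hx hx'
    exact hT.asymm (mem_inN.1 hx).2 (mem_outN.1 hx').2
  rw [← Finset.card_union_of_disjoint hd, ← Finset.card_erase_add_one hu]
  congr 2
  ext x
  simp only [Finset.mem_union, mem_inN, mem_outN, Finset.mem_erase]
  constructor
  · rintro (⟨h1, h2⟩ | ⟨h1, h2⟩)
    · exact ⟨fun h => hT.irrefl u (h ▸ h2), h1⟩
    · exact ⟨fun h => hT.irrefl u (h ▸ h2), h1⟩
  · rintro ⟨h1, h2⟩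
    rcases hT.total h1 with h | h
    · exact Or.inl ⟨h2, h⟩
    · exact Or.inr ⟨h2, h⟩

/-- `D` and `Y` are disjoint parts of the out-neighbourhood of `u`, so `D` loses `u`, its
in-neighbours and `Y`. -/
theorem card_le_outN_sub (hT : T.IsTournament) {S : Finset V} {u : V} (hu : u ∈ S)
    {D Y : Finset V} (hD : ∀ d ∈ D, d ∈ S ∧ T.Adj u d ∧ d ∉ Y) (hY : Y ⊆ T.outN S u) :
    D.card + (T.inN S u).card + Y.card + 1 ≤ S.card := by
  have h1 := card_inN_add_card_outN hT hu
  have h2 : (D ∪ Y).card ≤ (T.outN S u).card := by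
    refine Finset.card_le_card (Finset.union_subset ?_ hY)
    intro d hd
    exact mem_outN.2 ⟨(hD d hd).1, (hD d hd).2.1⟩
  rw [Finset.card_union_of_disjoint (Finset.disjoint_left.2 fun d hd => (hD d hd).2.2)] at h2
  omega

/-! ### The induction hypothesis and the weight of a class -/

/-- Every set smaller than `S` has at most `1.674 ^ m` maximal transitive subsets, where `m` is its
size. -/
def BoundedBelow (T : Digraph V) (S : Finset V) : Prop :=
  ∀ D : Finset V, D.card < S.card → ((T.maxTrans D).card : ℝ) ≤ (837 / 500 : ℝ) ^ D.card

theorem growth_pow_le {m n k : ℕ} (h : m + k ≤ n) :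
    (837 / 500 : ℝ) ^ m ≤ (837 / 500) ^ n * (500 / 837) ^ k := by
  have h1 : (837 / 500 : ℝ) ^ m = (837 / 500) ^ (m + k) * (500 / 837) ^ k := by
    rw [pow_add, mul_assoc, ← mul_pow]; norm_num
  rw [h1]
  exact mul_le_mul_of_nonneg_right (pow_le_pow_right₀ (by norm_num) h) (by positivity)

theorem BoundedBelow.card_le {S D : Finset V} (hS : T.BoundedBelow S) {k : ℕ}
    (h : D.card + (k + 1) ≤ S.card) :
    ((T.maxTrans D).card : ℝ) ≤ (837 / 500) ^ S.card * (500 / 837) ^ (k + 1) :=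
  (hS D (by omega)).trans (growth_pow_le h)

/-- The workhorse of the case analysis. The class is fixed by the trace `A` at `u` and the forbidden
set `X`; the saving may be measured at any vertex `w` of the prefix. It counts `w`, its
in-neighbours, and the out-neighbours `Y` of `w` that are forbidden or not dominated by the whole
prefix. -/
theorem BoundedBelow.cnt_le (hT : T.IsTournament) {S : Finset V} (hS : T.BoundedBelow S)
    {p : Finset V → Prop} (u : V) (A X : Finset V)
    (hp : ∀ W ∈ T.maxTrans S, p W → u ∈ W ∧ W ∩ T.inN S u = A ∧ Disjoint W X)
    (w : V) (hwS : w ∈ S) (hw : w ∈ insert u A) (Y : Finset V)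
    (hY : ∀ y ∈ Y, y ∈ S ∧ T.Adj w y ∧ (y ∈ X ∨ ∃ a ∈ insert u A, ¬ T.Adj a y)) (k : ℕ)
    (hk : k ≤ (T.inN S w).card + Y.card) :
    T.cnt S p ≤ (837 / 500) ^ S.card * (500 / 837) ^ (k + 1) := by
  refine (cnt_le_card_domBy hT u A X hp).trans (hS.card_le ?_)
  have := card_le_outN_sub hT hwS (D := T.domBy S u A X) (Y := Y) ?_ ?_
  · omega
  · intro d hd
    obtain ⟨h1, h2, h3, h4⟩ := mem_domBy.1 hd
    have h5 : ∀ a ∈ insert u A, T.Adj a d := by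
      intro a ha
      rcases Finset.mem_insert.1 ha with rfl | ha
      · exact h3
      · exact h4 a ha
    refine ⟨h1, h5 w hw, fun hdY => ?_⟩
    rcases (hY d hdY).2.2 with h | ⟨a, ha, h⟩
    · exact h2 h
    · exact h (h5 a ha)
  · intro y hy
    exact mem_outN.2 ⟨(hY y hy).1, (hY y hy).2.1⟩

theorem BoundedBelow.cnt_notMem_le (hT : T.IsTournament) {S : Finset V} (hS : T.BoundedBelow S)
    {v : V} (hv : v ∈ S) :
    T.cnt S (fun W => v ∉ W) ≤ (837 / 500) ^ S.card * (500 / 837) ^ 1 := by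
  refine (cnt_le_card_of_disjoint hT {v} fun W _ h => by simpa using h).trans
    (hS.card_le (k := 0) ?_)
  rw [← Finset.erase_eq, Finset.card_erase_of_mem hv]
  have := Finset.card_pos.2 ⟨v, hv⟩
  omega

theorem card_maxTrans_le_cnt_mem (S : Finset V) (v : V) :
    ((T.maxTrans S).card : ℝ) ≤ T.cnt S (fun W => v ∈ W) + T.cnt S (fun W => v ∉ W) := by
  rw [← cnt_true]
  exact cnt_le_add fun W _ _ => em _

theorem card_powerset_erase_empty {α : Type*} (s : Finset α) :
    (((s.powerset.erase ∅).card : ℕ) : ℝ) = 2 ^ s.card - 1 := by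
  rw [Finset.card_erase_of_mem (Finset.empty_mem_powerset s), Finset.card_powerset,
    Nat.cast_sub Nat.one_le_two_pow]
  simp

theorem le_growth_of_factor {F B c : ℝ} (hB : 0 ≤ B) (h : F ≤ B * c) (hc : c ≤ 1) : F ≤ B :=
  h.trans (mul_le_of_le_one_right hB hc)

/-! ### A vertex of in-degree at most two -/

theorem BoundedBelow.of_inN_eq_empty (hT : T.IsTournament) {S : Finset V} (hS : T.BoundedBelow S)
    {v : V} (hv : v ∈ S) (h0 : T.inN S v = ∅) :
    ((T.maxTrans S).card : ℝ) ≤ (837 / 500) ^ S.card := by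
  have h1 := card_maxTrans_le_cnt_mem (T := T) S v
  have h2 : T.cnt S (fun W => v ∉ W) = 0 := cnt_eq_zero fun W hW hvW => by
    obtain ⟨a, ha, b, hb, hav, -⟩ := exists_triangle_of_notMem hT hW hv hvW
    have : a ∈ T.inN S v := mem_inN.2 ⟨(mem_maxTrans.1 hW).1 ha, hav⟩
    simp [h0] at this
  have h3 := hS.cnt_le hT (p := fun W => v ∈ W) v ∅ ∅ (by simp [h0]) v hv (by simp) ∅ (by simp) 0
    (by simp)
  refine le_growth_of_factor (c := (500 / 837) ^ 1) (by positivity) ?_ (by norm_num)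
  linarith

theorem BoundedBelow.of_inN_eq_singleton (hT : T.IsTournament) {S : Finset V}
    (hS : T.BoundedBelow S) {v u : V} (hv : v ∈ S) (h1 : T.inN S v = {u}) :
    ((T.maxTrans S).card : ℝ) ≤ (837 / 500) ^ S.card := by
  have huv : u ∈ S ∧ T.Adj u v := mem_inN.1 (by simp [h1])
  have hcov := card_maxTrans_le_cnt_mem (T := T) S v
  have hin : T.cnt S (fun W => v ∈ W) ≤
      T.cnt S (fun W => v ∈ W ∧ u ∉ W) + T.cnt S (fun W => v ∈ W ∧ u ∈ W) :=
    cnt_le_add fun W _ h => by tauto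
  have ha := hS.cnt_le hT (p := fun W => v ∈ W ∧ u ∉ W) v ∅ ∅
    (by intro W _ h; simp [h1, h.1, h.2]) v hv (by simp) ∅ (by simp) 1 (by simp [h1])
  have hb := hS.cnt_le hT (p := fun W => v ∈ W ∧ u ∈ W) v {u} ∅
    (by intro W _ h; simp [h1, h.1, h.2]) u huv.1 (by simp) {v}
    (by simp [hv, huv.2, hT.irrefl]) ((T.inN S u).card + 1) (by simp)
  -- With four in-neighbours of `u`, merely deleting `v` suffices: `x + x^2 + x^6 ≤ 1`. Otherwise
  -- the sets omitting `v` are split by their trace on the in-neighbours of `u`. That trace is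
  -- nonempty, because the triangle through `v` must enter `v` from `u`.
  by_cases hj : 4 ≤ (T.inN S u).card
  · have hc := hS.cnt_notMem_le hT hv
    have hd : (500 / 837 : ℝ) ^ ((T.inN S u).card + 1 + 1) ≤ (500 / 837) ^ 6 :=
      pow_le_pow_of_le_one (by norm_num) (by norm_num) (by omega)
    have hB : (0 : ℝ) ≤ (837 / 500) ^ S.card := by positivity
    have he := mul_le_mul_of_nonneg_left hd hB
    refine le_growth_of_factor (c := (500 / 837) ^ 1 + (500 / 837) ^ 2 + (500 / 837) ^ 6) hB ?_
      (by norm_num)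
    linarith
  · have hc := cnt_le_card_mul (T := T) (S := S) (p := fun W => v ∉ W)
      ((T.inN S u).powerset.erase ∅)
      (fun A W => u ∈ W ∧ W ∩ T.inN S u = A ∧ Disjoint W {v}) _ ?_
      (fun A _ => hS.cnt_le hT u A {v} (fun W _ h => h) u huv.1 (by simp) {v}
        (by simp [hv, huv.2]) ((T.inN S u).card + 1) (by simp))
    · rw [card_powerset_erase_empty] at hc
      have hB : (0 : ℝ) ≤ (837 / 500) ^ S.card := by positivity
      refine le_growth_of_factor (c := (500 / 837) ^ 2 +
        2 ^ (T.inN S u).card * (500 / 837) ^ ((T.inN S u).card + 1 + 1)) hB ?_ ?_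
      · linarith
      · generalize (T.inN S u).card = j at hj ⊢
        interval_cases j <;> norm_num
    · intro W hW hvW
      obtain ⟨a, haW, b, hbW, hav, hvb, hba⟩ := exists_triangle_of_notMem hT hW hv hvW
      have hWS := (mem_maxTrans.1 hW).1
      have hau : a = u := by
        have : a ∈ T.inN S v := mem_inN.2 ⟨hWS haW, hav⟩
        simpa [h1] using this
      subst hau
      refine ⟨W ∩ T.inN S a, ?_, haW, rfl, by simpa using hvW⟩
      refine Finset.mem_erase.2 ⟨?_, Finset.mem_powerset.2 Finset.inter_subset_right⟩
      exact Finset.ne_empty_of_mem (Finset.mem_inter.2 ⟨hbW, mem_inN.2 ⟨hWS hbW, hba⟩⟩)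

/-- The four terms are the traces `∅`, `{u₁}`, `{u₂}`, `{u₁, u₂}` of `W` on the in-neighbours of
`v`. For the last one the saving can be measured at `u₁` or at `u₂`, whence the alternative for `j`.
Measuring at `u₁` gains one more, since `u₂` is then also a lost out-neighbour. -/
theorem BoundedBelow.cnt_mem_le_of_inN_eq_pair (hT : T.IsTournament) {S : Finset V}
    (hS : T.BoundedBelow S) {v u₁ u₂ : V} (hv : v ∈ S) (h : T.inN S v = {u₁, u₂})
    (h12 : T.Adj u₁ u₂) {j₁ j₂ j : ℕ} (hj₁ : j₁ ≤ (T.inN S u₁).card)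
    (hj₂ : j₂ ≤ (T.inN S u₂).card) (hj : j ≤ j₁ + 1 ∨ j ≤ j₂) :
    T.cnt S (fun W => v ∈ W) ≤ (837 / 500) ^ S.card * ((500 / 837) ^ 3 +
      (500 / 837) ^ (j₁ + 2 + 1) + (500 / 837) ^ (j₂ + 1 + 1) + (500 / 837) ^ (j + 1 + 1)) := by
  have h1 : u₁ ∈ S ∧ T.Adj u₁ v := mem_inN.1 (by simp [h])
  have h2 : u₂ ∈ S ∧ T.Adj u₂ v := mem_inN.1 (by simp [h])
  have hne : u₁ ≠ u₂ := fun e => hT.irrefl _ (e ▸ h12)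
  have hv2 : v ≠ u₂ := fun e => hT.irrefl _ (e ▸ h2.2)
  have n2 := hT.asymm h2.2
  have e0 : ∀ W : Finset V, W ∩ {u₁, u₂} = (if u₁ ∈ W then {u₁} else ∅) ∪
      (if u₂ ∈ W then {u₂} else ∅) := by
    intro W
    ext x
    simp only [Finset.mem_inter, Finset.mem_insert, Finset.mem_singleton, Finset.mem_union]
    split_ifs <;> simp <;> grind
  have ca := hS.cnt_le hT (p := fun W => v ∈ W ∧ u₁ ∉ W ∧ u₂ ∉ W) v ∅ ∅
    (by intro W _ hW; simp [h, e0, hW.1, hW.2]) v hv (by simp) ∅ (by simp) 2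
    (by simp [h, hne])
  have cb := hS.cnt_le hT (p := fun W => v ∈ W ∧ u₁ ∈ W ∧ u₂ ∉ W) v {u₁} ∅
    (by intro W _ hW; simp [h, e0, hW.1, hW.2]) u₁ h1.1 (by simp) {v, u₂}
    (by simp [hv, h1.2, h2.1, h12, hT.irrefl, n2]) (j₁ + 2) (by simpa [hv2])
  have cc := hS.cnt_le hT (p := fun W => v ∈ W ∧ u₁ ∉ W ∧ u₂ ∈ W) v {u₂} ∅
    (by intro W _ hW; simp [h, e0, hW.1, hW.2]) u₂ h2.1 (by simp) {v}
    (by simp [hv, h2.2, hT.irrefl]) (j₂ + 1) (by simpa)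
  have cd : T.cnt S (fun W => v ∈ W ∧ u₁ ∈ W ∧ u₂ ∈ W) ≤
      (837 / 500) ^ S.card * (500 / 837) ^ (j + 1 + 1) := by
    rcases hj with hj | hj
    · exact hS.cnt_le hT v {u₁, u₂} ∅
        (by intro W _ hW; simp [h, e0, hW.1, hW.2]) u₁ h1.1 (by simp) {v, u₂}
        (by simp [hv, h1.2, h2.1, h12, hT.irrefl, n2]) (j + 1) (by simp [hv2]; omega)
    · exact hS.cnt_le hT v {u₁, u₂} ∅
        (by intro W _ hW; simp [h, e0, hW.1, hW.2]) u₂ h2.1 (by simp) {v}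
        (by simp [hv, h2.2, hT.irrefl]) (j + 1) (by simp; omega)
  have c1 : T.cnt S (fun W => v ∈ W) ≤ T.cnt S (fun W => v ∈ W ∧ u₁ ∉ W) +
    T.cnt S (fun W => v ∈ W ∧ u₁ ∈ W) := cnt_le_add fun W _ _ => by tauto
  have c2 : T.cnt S (fun W => v ∈ W ∧ u₁ ∉ W) ≤ T.cnt S (fun W => v ∈ W ∧ u₁ ∉ W ∧ u₂ ∉ W) +
    T.cnt S (fun W => v ∈ W ∧ u₁ ∉ W ∧ u₂ ∈ W) := cnt_le_add fun W _ _ => by tauto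
  have c3 : T.cnt S (fun W => v ∈ W ∧ u₁ ∈ W) ≤ T.cnt S (fun W => v ∈ W ∧ u₁ ∈ W ∧ u₂ ∉ W) +
    T.cnt S (fun W => v ∈ W ∧ u₁ ∈ W ∧ u₂ ∈ W) := cnt_le_add fun W _ _ => by tauto
  linarith

/-- Here the sets containing `v` are light enough for the crude weight `x` of the sets omitting `v`.
-/
theorem BoundedBelow.of_inN_eq_pair_of_large (hT : T.IsTournament) {S : Finset V}
    (hS : T.BoundedBelow S) {v u₁ u₂ : V} (hv : v ∈ S) (h : T.inN S v = {u₁, u₂})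
    (h12 : T.Adj u₁ u₂) (hj₁ : 2 ≤ (T.inN S u₁).card) (hj₂ : 2 ≤ (T.inN S u₂).card)
    (hj : 4 ≤ (T.inN S u₁).card ∨ 4 ≤ (T.inN S u₂).card ∨
      3 ≤ (T.inN S u₁).card ∧ 3 ≤ (T.inN S u₂).card) :
    ((T.maxTrans S).card : ℝ) ≤ (837 / 500) ^ S.card := by
  have h0 := card_maxTrans_le_cnt_mem (T := T) S v
  have hn := hS.cnt_notMem_le hT hv
  have key : ∃ c : ℝ, T.cnt S (fun W => v ∈ W) ≤ (837 / 500) ^ S.card * c ∧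
      c + (500 / 837) ^ 1 ≤ 1 := by
    rcases hj with hj | hj | ⟨hj, hj'⟩
    · exact ⟨_, hS.cnt_mem_le_of_inN_eq_pair hT hv h h12 hj hj₂ (j := 5) (by norm_num),
        by norm_num⟩
    · exact ⟨_, hS.cnt_mem_le_of_inN_eq_pair hT hv h h12 hj₁ hj (j := 4) (by norm_num),
        by norm_num⟩
    · exact ⟨_, hS.cnt_mem_le_of_inN_eq_pair hT hv h h12 hj hj' (j := 4) (by norm_num),
        by norm_num⟩
  obtain ⟨c, hc, hc1⟩ := key
  refine le_growth_of_factor (by positivity) ?_ hc1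
  linarith

theorem BoundedBelow.of_inN_eq_pair_of_card_eq_two (hT : T.IsTournament) {S : Finset V}
    (hS : T.BoundedBelow S) {v u₁ u₂ : V} (hv : v ∈ S) (h : T.inN S v = {u₁, u₂})
    (h12 : T.Adj u₁ u₂) (hj₁ : (T.inN S u₁).card = 2 ∨ (T.inN S u₁).card = 3)
    (hj₂ : (T.inN S u₂).card = 2) :
    ((T.maxTrans S).card : ℝ) ≤ (837 / 500) ^ S.card := by
  have h1 : u₁ ∈ S ∧ T.Adj u₁ v := mem_inN.1 (by simp [h])
  have h2 : u₂ ∈ S ∧ T.Adj u₂ v := mem_inN.1 (by simp [h])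
  have hne : u₁ ≠ u₂ := fun e => hT.irrefl _ (e ▸ h12)
  have hv2 : v ≠ u₂ := fun e => hT.irrefl _ (e ▸ h2.2)
  have h12' : u₁ ∈ T.inN S u₂ := mem_inN.2 ⟨h1.1, h12⟩
  obtain ⟨w, hw⟩ : ∃ w, (T.inN S u₂).erase u₁ = {w} := by
    rw [← Finset.card_eq_one, Finset.card_erase_of_mem h12', hj₂]
  have hi2 : T.inN S u₂ = {u₁, w} := by rw [← Finset.insert_erase h12', hw]
  have hc0 := card_maxTrans_le_cnt_mem (T := T) S v
  have hc1 := hS.cnt_mem_le_of_inN_eq_pair hT hv h h12 le_rfl hj₂.ge (Or.inl le_rfl)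
  have hc2 : T.cnt S (fun W => v ∉ W) ≤ T.cnt S (fun W => v ∉ W ∧ u₂ ∉ W) +
    T.cnt S (fun W => v ∉ W ∧ u₂ ∈ W) := cnt_le_add fun W _ _ => by tauto
  have hblock : ∀ W ∈ T.maxTrans S, v ∉ W → ∃ a ∈ W, ∃ b ∈ W, (a = u₁ ∨ a = u₂) ∧ b ≠ u₁ ∧
      T.Adj b a ∧ b ∈ S := by
    intro W hW hvW
    obtain ⟨a, haW, b, hbW, hav, hvb, hba⟩ := exists_triangle_of_notMem hT hW hv hvW
    have hWS := (mem_maxTrans.1 hW).1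
    have : a ∈ T.inN S v := mem_inN.2 ⟨hWS haW, hav⟩
    refine ⟨a, haW, b, hbW, by simpa [h] using this, ?_, hba, hWS hbW⟩
    rintro rfl
    exact hT.asymm hvb h1.2
  have hc3 := cnt_le_card_mul (T := T) (S := S) (p := fun W => v ∉ W ∧ u₂ ∉ W)
    ((T.inN S u₁).powerset.erase ∅)
    (fun A W => u₁ ∈ W ∧ W ∩ T.inN S u₁ = A ∧ Disjoint W {v, u₂}) _ ?_
    (fun A _ => hS.cnt_le hT u₁ A {v, u₂} (fun W _ h => h) u₁ h1.1 (by simp) {v, u₂}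
      (by simp [hv, h1.2, h2.1, h12]) ((T.inN S u₁).card + 2) (by simp [hv2]))
  swap
  · rintro W hW ⟨hvW, h2W⟩
    obtain ⟨a, haW, b, hbW, ha, hb, hba, hbS⟩ := hblock W hW hvW
    obtain rfl : a = u₁ := ha.resolve_right fun e => h2W (e ▸ haW)
    refine ⟨W ∩ T.inN S a, ?_, haW, rfl, by simp [hvW, h2W]⟩
    refine Finset.mem_erase.2 ⟨?_, Finset.mem_powerset.2 Finset.inter_subset_right⟩
    exact Finset.ne_empty_of_mem (Finset.mem_inter.2 ⟨hbW, mem_inN.2 ⟨hbS, hba⟩⟩)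
  have hc4 : T.cnt S (fun W => v ∉ W ∧ u₂ ∈ W) ≤
      T.cnt S (fun W => u₂ ∈ W ∧ W ∩ T.inN S u₂ = {w} ∧ Disjoint W {v}) +
      T.cnt S (fun W => u₂ ∈ W ∧ W ∩ T.inN S u₂ = {u₁, w} ∧ Disjoint W {v}) := by
    refine cnt_le_add ?_
    rintro W hW ⟨hvW, h2W⟩
    -- The triangle vertex `b` precedes `u₁` or `u₂`, hence precedes `u₂` by transitivity; as `b ≠
    -- u₁`, it can only be `w`.
    have hwW : w ∈ W := by
      obtain ⟨a, haW, b, hbW, ha, hb, hba, hbS⟩ := hblock W hW hvW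
      have hb2 : T.Adj b u₂ := by
        rcases ha with rfl | rfl
        · exact (mem_maxTrans.1 hW).2.1 b hbW a haW u₂ h2W hba h12
        · exact hba
      have : b ∈ T.inN S u₂ := mem_inN.2 ⟨hbS, hb2⟩
      have : b = w := by simpa [hi2, hb] using this
      exact this ▸ hbW
    by_cases h1W : u₁ ∈ W
    · refine Or.inr ⟨h2W, ?_, by simpa using hvW⟩
      rw [hi2]
      exact Finset.inter_eq_right.2 (by simp [Finset.insert_subset_iff, h1W, hwW])
    · refine Or.inl ⟨h2W, ?_, by simpa using hvW⟩
      rw [hi2, Finset.inter_insert_of_notMem h1W]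
      exact Finset.inter_eq_right.2 (by simp [hwW])
  have hc5 := hS.cnt_le hT u₂ {w} {v} (fun W _ (h : u₂ ∈ W ∧ W ∩ T.inN S u₂ = {w} ∧
    Disjoint W {v}) => h) u₂ h2.1 (by simp) {v} (by simp [hv, h2.2]) 3 (by simp [hj₂])
  have hc6 := hS.cnt_le hT u₂ {u₁, w} {v} (fun W _ (h : u₂ ∈ W ∧ W ∩ T.inN S u₂ = {u₁, w} ∧
    Disjoint W {v}) => h) u₁ h1.1 (by simp) {v, u₂}
    (by simp [hv, h2.1, h1.2, h12, hT.irrefl]) ((T.inN S u₁).card + 2) (by simp [hv2])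
  rw [card_powerset_erase_empty] at hc3
  have hB : (0 : ℝ) ≤ (837 / 500) ^ S.card := by positivity
  refine le_growth_of_factor (c := (500 / 837) ^ 3 + 2 * (500 / 837) ^ 4 +
    (2 ^ (T.inN S u₁).card + 2) * (500 / 837) ^ ((T.inN S u₁).card + 2 + 1)) hB ?_ ?_
  · have e : (500 / 837 : ℝ) ^ ((T.inN S u₁).card + 1 + 1 + 1) =
      (500 / 837 : ℝ) ^ ((T.inN S u₁).card + 2 + 1) := by congr 1
    rw [e] at hc1
    linarith
  · rcases hj₁ with hj | hj <;> rw [hj] <;> norm_num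

theorem exists_eq_pair_of_card_eq_two (hT : T.IsTournament) {A : Finset V} (h : A.card = 2) :
    ∃ p q, A = {p, q} ∧ T.Adj p q := by
  obtain ⟨p, q, hpq, rfl⟩ := Finset.card_eq_two.1 h
  rcases hT.total hpq with h | h
  · exact ⟨p, q, rfl, h⟩
  · exact ⟨q, p, Finset.pair_comm p q, h⟩

theorem BoundedBelow.of_inN_eq_pair_of_two_three (hT : T.IsTournament) {S : Finset V}
    (hS : T.BoundedBelow S) {v u₁ u₂ : V} (hv : v ∈ S) (h : T.inN S v = {u₁, u₂})
    (h12 : T.Adj u₁ u₂) (hj₁ : (T.inN S u₁).card = 2) (hj₂ : (T.inN S u₂).card = 3)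
    (hdeg : ∀ w ∈ S, 2 ≤ (T.inN S w).card) :
    ((T.maxTrans S).card : ℝ) ≤ (837 / 500) ^ S.card := by
  have h1 : u₁ ∈ S ∧ T.Adj u₁ v := mem_inN.1 (by simp [h])
  have h2 : u₂ ∈ S ∧ T.Adj u₂ v := mem_inN.1 (by simp [h])
  have hne : u₁ ≠ u₂ := fun e => hT.irrefl _ (e ▸ h12)
  have hv2 : v ≠ u₂ := fun e => hT.irrefl _ (e ▸ h2.2)
  have h12' : u₁ ∈ T.inN S u₂ := mem_inN.2 ⟨h1.1, h12⟩
  have hi2 : ((T.inN S u₂).erase u₁).card = 2 := by rw [Finset.card_erase_of_mem h12', hj₂]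
  obtain ⟨p, q, hi1, hpq⟩ := exists_eq_pair_of_card_eq_two hT hj₁
  have hp : p ∈ S ∧ T.Adj p u₁ := mem_inN.1 (by simp [hi1])
  have hq : q ∈ S ∧ T.Adj q u₁ := mem_inN.1 (by simp [hi1])
  have hqu2 : q ≠ u₂ := fun e => hT.asymm h12 (e ▸ hq.2)
  -- Minimum in-degree two supplies a `z ≠ v` beating `p`. When `p ∈ W`, this out-neighbour of `u₁`
  -- is lost in addition to `v`.
  obtain ⟨z, hz, hzv⟩ : ∃ z ∈ T.inN S p, z ≠ v := by
    by_contra! hcon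
    have := (Finset.card_le_card (fun z hz => Finset.mem_singleton.2 (hcon z hz) :
      T.inN S p ⊆ {v})).trans (Finset.card_singleton v).le
    have := hdeg p hp.1
    omega
  obtain ⟨hzS, hzp⟩ := mem_inN.1 hz
  have h1z : T.Adj u₁ z := by
    refine (hT.total (fun e : u₁ = z => hT.asymm hp.2 (e ▸ hzp))).resolve_right fun hz1 => ?_
    have : z ∈ T.inN S u₁ := mem_inN.2 ⟨hzS, hz1⟩
    rw [hi1] at this
    rcases Finset.mem_insert.1 this with e | e
    · exact hT.irrefl _ (e ▸ hzp)
    · exact hT.asymm hpq (Finset.mem_singleton.1 e ▸ hzp)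
  set M := T.inN S u₂ ∩ T.outN S u₁ with hM
  have hMsub : M ⊆ (T.inN S u₂).erase u₁ := fun y hy => by
    obtain ⟨hy1, hy2⟩ := Finset.mem_inter.1 hy
    exact Finset.mem_erase.2 ⟨fun e => hT.irrefl _ (e ▸ (mem_outN.1 hy2).2), hy1⟩
  have hMcard : M.card ≤ 2 := hi2 ▸ Finset.card_le_card hMsub
  have hblock : ∀ W ∈ T.maxTrans S, v ∉ W → ∃ a ∈ W, ∃ b ∈ W, (a = u₁ ∨ a = u₂) ∧ b ≠ u₁ ∧
      T.Adj b a ∧ b ∈ S := by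
    intro W hW hvW
    obtain ⟨a, haW, b, hbW, hav, hvb, hba⟩ := exists_triangle_of_notMem hT hW hv hvW
    have hWS := (mem_maxTrans.1 hW).1
    have : a ∈ T.inN S v := mem_inN.2 ⟨hWS haW, hav⟩
    refine ⟨a, haW, b, hbW, by simpa [h] using this, ?_, hba, hWS hbW⟩
    rintro rfl
    exact hT.asymm hvb h1.2
  have hc0 := card_maxTrans_le_cnt_mem (T := T) S v
  have hc1 := hS.cnt_mem_le_of_inN_eq_pair hT hv h h12 hj₁.ge hj₂.ge (Or.inr le_rfl)
  have hc2 : T.cnt S (fun W => v ∉ W) ≤ T.cnt S (fun W => v ∉ W ∧ u₁ ∉ W) +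
    T.cnt S (fun W => v ∉ W ∧ u₁ ∈ W) := cnt_le_add fun W _ _ => by tauto
  -- `u₁ ∉ W`
  have hc3 := cnt_le_card_mul (T := T) (S := S) (p := fun W => v ∉ W ∧ u₁ ∉ W)
    (((T.inN S u₂).erase u₁).powerset.erase ∅)
    (fun A W => u₂ ∈ W ∧ W ∩ T.inN S u₂ = A ∧ Disjoint W {v}) _ ?_
    (fun A _ => hS.cnt_le hT u₂ A {v} (fun W _ h => h) u₂ h2.1 (by simp) {v}
      (by simp [hv, h2.2]) 4 (by simp [hj₂]))
  swap
  · rintro W hW ⟨hvW, h1W⟩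
    obtain ⟨a, haW, b, hbW, ha, hb, hba, hbS⟩ := hblock W hW hvW
    obtain rfl : a = u₂ := ha.resolve_left fun e => h1W (e ▸ haW)
    refine ⟨W ∩ T.inN S a, ?_, haW, rfl, by simpa using hvW⟩
    refine Finset.mem_erase.2 ⟨?_, Finset.mem_powerset.2 fun y hy => ?_⟩
    · exact Finset.ne_empty_of_mem (Finset.mem_inter.2 ⟨hbW, mem_inN.2 ⟨hbS, hba⟩⟩)
    · obtain ⟨hy1, hy2⟩ := Finset.mem_inter.1 hy
      exact Finset.mem_erase.2 ⟨fun e => h1W (e ▸ hy1), hy2⟩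
  -- `u₁ ∈ W`
  have hc4 : T.cnt S (fun W => v ∉ W ∧ u₁ ∈ W) ≤ T.cnt S (fun W => v ∉ W ∧ u₁ ∈ W ∧ p ∈ W) +
    T.cnt S (fun W => v ∉ W ∧ u₁ ∈ W ∧ p ∉ W) := cnt_le_add fun W _ _ => by tauto
  have hc5 : T.cnt S (fun W => v ∉ W ∧ u₁ ∈ W ∧ p ∉ W) ≤
    T.cnt S (fun W => v ∉ W ∧ u₁ ∈ W ∧ p ∉ W ∧ q ∈ W) +
    T.cnt S (fun W => v ∉ W ∧ u₁ ∈ W ∧ p ∉ W ∧ q ∉ W) := cnt_le_add fun W _ _ => by tauto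
  have hc6 := cnt_le_card_mul (T := T) (S := S) (p := fun W => v ∉ W ∧ u₁ ∈ W ∧ p ∈ W)
    {{p}, {p, q}} (fun A W => u₁ ∈ W ∧ W ∩ T.inN S u₁ = A ∧ Disjoint W {v}) _ ?_
    (fun A hA => hS.cnt_le hT u₁ A {v} (fun W _ h => h) u₁ h1.1 (by simp) {v, z} ?_ 4
      (by simp [hj₁, hzv.symm]))
  rotate_left
  · rintro W hW ⟨hvW, h1W, hpW⟩
    refine ⟨W ∩ T.inN S u₁, ?_, h1W, rfl, by simpa using hvW⟩
    rw [hi1, Finset.inter_insert_of_mem hpW]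
    by_cases hqW : q ∈ W
    · simp [hqW]
    · simp [hqW]
  · have hpA : p ∈ A := by
      rcases Finset.mem_insert.1 hA with rfl | hA
      · simp
      · simp [Finset.mem_singleton.1 hA]
    intro y hy
    rcases Finset.mem_insert.1 hy with rfl | hy
    · exact ⟨hv, h1.2, by simp⟩
    · rw [Finset.mem_singleton] at hy
      subst hy
      exact ⟨hzS, h1z, Or.inr ⟨p, Finset.mem_insert_of_mem hpA, hT.asymm hzp⟩⟩
  have hcard6 : (({{p}, {p, q}} : Finset (Finset V)).card : ℝ) ≤ 2 := by
    exact_mod_cast Finset.card_le_two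
  -- If `u₂` beats `q`, then `u₂` is lost too. The weaker saving `k = 3` occurs only for `q → u₂`,
  -- which is compensated below by a smaller `M`.
  have hc7 : ∃ k, (k = 4 ∨ k = 3 ∧ T.Adj q u₂) ∧
      T.cnt S (fun W => v ∉ W ∧ u₁ ∈ W ∧ p ∉ W ∧ q ∈ W) ≤
      (837 / 500) ^ S.card * (500 / 837) ^ (k + 1) := by
    have hcls : ∀ W ∈ T.maxTrans S, (v ∉ W ∧ u₁ ∈ W ∧ p ∉ W ∧ q ∈ W) →
        u₁ ∈ W ∧ W ∩ T.inN S u₁ = {q} ∧ Disjoint W {v} := by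
      rintro W hW ⟨hvW, h1W, hpW, hqW⟩
      exact ⟨h1W, by simp [hi1, hpW, hqW], by simpa using hvW⟩
    rcases hT.total hqu2 with hqu | hqu
    · exact ⟨3, Or.inr ⟨rfl, hqu⟩, hS.cnt_le hT u₁ {q} {v} hcls u₁ h1.1 (by simp) {v}
        (by simp [hv, h1.2]) 3 (by simp [hj₁])⟩
    · exact ⟨4, Or.inl rfl, hS.cnt_le hT u₁ {q} {v} hcls u₁ h1.1 (by simp) {v, u₂}
        (by simp [hv, h1.2, h2.1, h12, hT.asymm hqu]) 4 (by simp [hj₁, hv2])⟩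
  -- Now `u₁` is the source of `W`, so the triangle enters `v` from `u₂` and the trace of `W` on `M`
  -- is nonempty. The remainder after the prefix up to `u₂` avoids `M`, which adds `|M|` to the
  -- saving.
  have hc8 := cnt_le_card_mul (T := T) (S := S) (p := fun W => v ∉ W ∧ u₁ ∈ W ∧ p ∉ W ∧ q ∉ W)
    (M.powerset.erase ∅)
    (fun A W => u₂ ∈ W ∧ W ∩ T.inN S u₂ = insert u₁ A ∧ Disjoint W {v}) _ ?_
    (fun A _ => hS.cnt_le hT u₂ (insert u₁ A) {v} (fun W _ h => h) u₁ h1.1 (by simp)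
      (insert v (insert u₂ M)) ?_ (4 + M.card) ?_)
  rotate_left
  · rintro W hW ⟨hvW, h1W, hpW, hqW⟩
    have hWS := (mem_maxTrans.1 hW).1
    have hout : ∀ y ∈ W, y ≠ u₁ → T.Adj u₁ y := fun y hy hy1 => by
      refine (hT.total hy1).resolve_left fun hyu => ?_
      have : y ∈ T.inN S u₁ := mem_inN.2 ⟨hWS hy, hyu⟩
      rw [hi1, Finset.mem_insert, Finset.mem_singleton] at this
      rcases this with rfl | rfl <;> contradiction
    obtain ⟨a, haW, b, hbW, ha, hb, hba, hbS⟩ := hblock W hW hvW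
    have h1b := hout b hbW hb
    obtain rfl : a = u₂ := ha.resolve_left fun e => hT.asymm h1b (e ▸ hba)
    refine ⟨W ∩ M, ?_, haW, ?_, by simpa using hvW⟩
    · refine Finset.mem_erase.2 ⟨?_, Finset.mem_powerset.2 Finset.inter_subset_right⟩
      exact Finset.ne_empty_of_mem (Finset.mem_inter.2 ⟨hbW, Finset.mem_inter.2
        ⟨mem_inN.2 ⟨hbS, hba⟩, mem_outN.2 ⟨hbS, h1b⟩⟩⟩)
    · ext y
      simp only [Finset.mem_inter, Finset.mem_insert, hM, mem_inN, mem_outN]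
      constructor
      · rintro ⟨hy1, hy2, hy3⟩
        by_cases hy : y = u₁
        · exact Or.inl hy
        · exact Or.inr ⟨hy1, ⟨hy2, hy3⟩, hy2, hout y hy1 hy⟩
      · rintro (rfl | ⟨hy1, hy2, -⟩)
        · exact ⟨h1W, h1.1, h12⟩
        · exact ⟨hy1, hy2⟩
  · intro y hy
    rcases Finset.mem_insert.1 hy with rfl | hy
    · exact ⟨hv, h1.2, by simp⟩
    rcases Finset.mem_insert.1 hy with rfl | hy
    · exact ⟨h2.1, h12, Or.inr ⟨y, by simp, hT.irrefl y⟩⟩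
    · obtain ⟨hy1, hy2⟩ := Finset.mem_inter.1 hy
      exact ⟨(mem_outN.1 hy2).1, (mem_outN.1 hy2).2,
        Or.inr ⟨u₂, by simp, hT.asymm (mem_inN.1 hy1).2⟩⟩
  · have hu2M : u₂ ∉ M := fun hy => hT.irrefl _ (mem_inN.1 (Finset.mem_inter.1 hy).1).2
    have hvM : v ∉ M := fun hy => hT.asymm h2.2 (mem_inN.1 (Finset.mem_inter.1 hy).1).2
    rw [Finset.card_insert_of_notMem (by simp [hv2, hvM]), Finset.card_insert_of_notMem hu2M, hj₁]
    omega
  obtain ⟨k, hk, hc7⟩ := hc7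
  rw [card_powerset_erase_empty] at hc3 hc8
  rw [hi2] at hc3
  have hB : (0 : ℝ) ≤ (837 / 500) ^ S.card := by positivity
  have hc6' := hc6.trans (mul_le_mul_of_nonneg_right hcard6 (by positivity))
  refine le_growth_of_factor (c := (500 / 837) ^ 3 + 8 * (500 / 837) ^ 5 +
    (500 / 837) ^ (k + 1) + (2 ^ M.card - 1) * (500 / 837) ^ (4 + M.card + 1)) hB ?_ ?_
  · norm_num at hc0 hc1 hc2 hc3 hc4 hc5 hc6' ⊢
    linarith
  · rcases hk with rfl | ⟨rfl, hqu⟩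
    · generalize M.card = c at hMcard
      interval_cases c <;> norm_num
    -- `q` is one of the two in-neighbours of `u₂` other than `u₁`, but it is not an out-neighbour
    -- of `u₁`.
    · have hMc : M.card ≤ 1 := by
        have hqM : q ∉ M := fun hqM => hT.asymm hq.2 (mem_outN.1 (Finset.mem_inter.1 hqM).2).2
        have : M ⊆ ((T.inN S u₂).erase u₁).erase q := fun y hy =>
          Finset.mem_erase.2 ⟨fun e => hqM (e ▸ hy), hMsub hy⟩
        have := Finset.card_le_card this
        rwa [Finset.card_erase_of_mem, hi2] at this
        exact Finset.mem_erase.2 ⟨fun e => hT.irrefl _ (e ▸ hq.2), mem_inN.2 ⟨hq.1, hqu⟩⟩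
      generalize M.card = c at hMc
      interval_cases c <;> norm_num

end Digraph

/-! ### In-degrees at least three: Landau's inequality and hinge functions -/

/-- A geometric term written as a combination of the hinge functions `(k + 1 - t)⁺`. -/
theorem hasSum_hinge {x : ℝ} (h0 : 0 ≤ x) (h1 : x < 1) (t : ℕ) :
    HasSum (fun k : ℕ => (1 - x) ^ 2 * x ^ k * ((k + 1 - t : ℕ) : ℝ)) (x ^ t) := by
  have hx : ‖x‖ < 1 := by rwa [Real.norm_of_nonneg h0]
  have h := (hasSum_choose_mul_geometric_of_norm_lt_one 1 hx).mul_left ((1 - x) ^ 2 * x ^ t)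
  rw [mul_one_div, show (1 - x) ^ (1 + 1) = (1 - x) ^ 2 from rfl,
    mul_div_cancel_left₀ _ (pow_ne_zero 2 (sub_pos.2 h1).ne')] at h
  -- Truncated subtraction kills the terms `k < t`; the others are the series `∑ (k + 1) x ^ k = (1
  -- - x)⁻²` shifted by `t`.
  have hz : ∑ k ∈ Finset.range t, (1 - x) ^ 2 * x ^ k * ((k + 1 - t : ℕ) : ℝ) = 0 := by
    refine Finset.sum_eq_zero fun k hk => ?_
    have : k + 1 - t = 0 := by have := Finset.mem_range.1 hk; omega
    simp [this]
  rw [← add_zero (x ^ t), ← hz, ← hasSum_nat_add_iff]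
  refine Eq.mp (congrArg (HasSum · (x ^ t)) (funext fun k => ?_)) h
  simp only [show k + t + 1 - t = k + 1 by omega, Nat.choose_one_right, pow_add]
  ring

/-- Only the `N` vertices with `t v ≤ k` contribute, so Landau's inequality bounds the sum by `N(k +
1) - N(N - 1)/2`, which is largest at `N = k + 1` and `N = k + 2`. The corrections for `k ≤ 4` come
from `t v ≥ 3`: nothing contributes for `k < 3`, and for `k = 3, 4` the sum is at most `N(k - 2)`,
used when `N ≤ 7`. -/
theorem sum_hinge_le {V : Type*} {S : Finset V} {t : V → ℕ}
    (ht : ∀ U ⊆ S, (U.card : ℝ) * (U.card - 1) ≤ 2 * ∑ v ∈ U, (t v : ℝ))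
    (h3 : ∀ v ∈ S, 3 ≤ t v) (k : ℕ) :
    ∑ v ∈ S, ((k + 1 - t v : ℕ) : ℝ) ≤ ((k + 2).choose 2 : ℕ) -
      (if k = 0 then 1 else if k = 1 then 3 else if k = 2 then 6 else if k = 3 then 3 else
        if k = 4 then 1 else 0) := by
  classical
  set U := S.filter fun v => t v ≤ k with hU
  have hUS : U ⊆ S := Finset.filter_subset _ _
  have e1 : ∑ v ∈ S, ((k + 1 - t v : ℕ) : ℝ) = ∑ v ∈ U, ((k + 1 : ℝ) - t v) := by
    rw [hU, Finset.sum_filter]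
    refine Finset.sum_congr rfl fun v _ => ?_
    split_ifs with h
    · rw [Nat.cast_sub (by omega)]; push_cast; ring
    · rw [show k + 1 - t v = 0 by omega]; simp
  rw [e1, Finset.sum_sub_distrib, Finset.sum_const, nsmul_eq_mul]
  have h1 := ht U hUS
  have h2 : (U.card : ℝ) * 3 ≤ ∑ v ∈ U, (t v : ℝ) := by
    rw [← nsmul_eq_mul]
    exact Finset.card_nsmul_le_sum _ _ _ fun v hv => by exact_mod_cast h3 v (hUS hv)
  have hch : (((k + 2).choose 2 : ℕ) : ℝ) = (k + 1) * (k + 2) / 2 := by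
    rw [Nat.cast_choose_two]; push_cast; ring
  rw [hch]
  have h0 : k < 3 → U = ∅ := fun hk => Finset.filter_eq_empty_iff.2 fun v hv h => by
    have := h3 v hv; omega
  by_cases hk3 : k < 3
  · rw [h0 hk3]
    interval_cases k <;> norm_num
  by_cases hk5 : k < 5
  · rcases Nat.lt_or_ge U.card 8 with hN | hN
    · have hN' : (U.card : ℝ) ≤ 7 := by exact_mod_cast (by omega : U.card ≤ 7)
      interval_cases k
      · norm_num; linarith
      · norm_num; linarith
    · have hN' : (8 : ℝ) ≤ U.card := by exact_mod_cast hN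
      interval_cases k
      · norm_num; nlinarith
      · norm_num; nlinarith
  · rw [if_neg (by omega), if_neg (by omega), if_neg (by omega), if_neg (by omega),
      if_neg (by omega)]
    have h5 : (0 : ℝ) ≤ ((U.card : ℝ) - (k + 1)) * ((U.card : ℝ) - (k + 2)) := by
      rcases Nat.lt_or_ge U.card (k + 2) with h | h
      · have h' : (U.card : ℝ) ≤ k + 1 := by exact_mod_cast (by omega : U.card ≤ k + 1)
        exact mul_nonneg_of_nonpos_of_nonpos (by linarith) (by linarith)
      · have h' : (k + 2 : ℝ) ≤ U.card := by exact_mod_cast h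
        exact mul_nonneg (by linarith) (by linarith)
    nlinarith

theorem sum_pow_le_of_landau {V : Type*} {S : Finset V} {t : V → ℕ}
    (ht : ∀ U ⊆ S, (U.card : ℝ) * (U.card - 1) ≤ 2 * ∑ v ∈ U, (t v : ℝ))
    (h3 : ∀ v ∈ S, 3 ≤ t v) : ∑ v ∈ S, (500 / 837 : ℝ) ^ t v ≤ 837 / 500 := by
  have hl := hasSum_sum fun v (_ : v ∈ S) =>
    hasSum_hinge (x := 500 / 837) (by norm_num) (by norm_num) (t v)
  set c : ℕ → ℝ := fun k => if k = 0 then 1 else if k = 1 then 3 else if k = 2 then 6 else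
    if k = 3 then 3 else if k = 4 then 1 else 0 with hc
  have hx : ‖(500 / 837 : ℝ)‖ < 1 := by rw [Real.norm_of_nonneg (by norm_num)]; norm_num
  -- The uncorrected series sums to `1 / (1 - x) ≈ 2.48`, too large; subtracting the corrections `c`
  -- brings it below `1.674`.
  have hr1 := (hasSum_choose_mul_geometric_of_norm_lt_one 2 hx).mul_left ((1 - 500 / 837 : ℝ) ^ 2)
  have hr2 : HasSum (fun k => (1 - 500 / 837 : ℝ) ^ 2 * (500 / 837) ^ k * c k)
      (∑ k ∈ Finset.range 5, (1 - 500 / 837 : ℝ) ^ 2 * (500 / 837) ^ k * c k) := by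
    refine hasSum_sum_of_ne_finset_zero fun k hk => ?_
    have : 5 ≤ k := by simpa using hk
    simp only [hc]
    rw [if_neg (by omega), if_neg (by omega), if_neg (by omega), if_neg (by omega),
      if_neg (by omega), mul_zero]
  have hle := hasSum_le (fun k => ?_) hl (hr1.sub hr2)
  · refine hle.trans ?_
    simp only [Finset.sum_range_succ, Finset.sum_range_zero, hc]
    norm_num
  · have := mul_le_mul_of_nonneg_left (sum_hinge_le ht h3 k)
      (by positivity : (0 : ℝ) ≤ (1 - 500 / 837) ^ 2 * (500 / 837) ^ k)
    rw [Finset.mul_sum] at this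
    refine this.trans (le_of_eq ?_)
    simp only [hc]
    ring

namespace Digraph

open scoped Classical

variable {V : Type*} {T : Digraph V}

/-- Landau's inequality for the in-degrees of a tournament. -/
theorem landau (hT : T.IsTournament) {S U : Finset V} (hU : U ⊆ S) :
    (U.card : ℝ) * (U.card - 1) ≤ 2 * ∑ v ∈ U, ((T.inN S v).card : ℝ) := by
  have h1 : ∑ v ∈ U, (T.inN U v).card = ∑ v ∈ U, (T.outN U v).card :=
    (Finset.sum_card_bipartiteAbove_eq_sum_card_bipartiteBelow
      (s := U) (t := U) (fun a b => T.Adj a b)).symm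
  have h2 : ∑ v ∈ U, (((T.inN U v).card : ℝ) + (T.outN U v).card) = U.card * (U.card - 1) := by
    rw [← nsmul_eq_mul]
    refine Finset.sum_eq_card_nsmul fun v hv => ?_
    rw [← card_inN_add_card_outN hT hv]
    push_cast
    ring
  have h3 : ∑ v ∈ U, ((T.inN U v).card : ℝ) ≤ ∑ v ∈ U, ((T.inN S v).card : ℝ) :=
    Finset.sum_le_sum fun v _ => by
      exact_mod_cast Finset.card_le_card (Finset.filter_subset_filter _ hU)
  have h4 : ∑ v ∈ U, ((T.inN U v).card : ℝ) = ∑ v ∈ U, ((T.outN U v).card : ℝ) := by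
    exact_mod_cast h1
  rw [Finset.sum_add_distrib] at h2
  linarith

theorem exists_source (hT : T.IsTournament) {S W : Finset V} (hW : W ∈ T.maxTrans S)
    (hS : S.Nonempty) : ∃ v ∈ W, W ∩ T.inN S v = ∅ := by
  have hne : W.Nonempty := by
    obtain ⟨s, hs⟩ := hS
    by_cases hsW : s ∈ W
    · exact ⟨s, hsW⟩
    · obtain ⟨a, ha, -⟩ := exists_triangle_of_notMem hT hW hs hsW
      exact ⟨a, ha⟩
  -- By transitivity an in-neighbour of `v` inside `W` would have a strictly smaller trace.
  obtain ⟨v, hv, hmin⟩ := Finset.exists_min_image W (fun v => (W ∩ T.inN S v).card) hne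
  refine ⟨v, hv, Finset.eq_empty_of_forall_notMem fun a ha => ?_⟩
  obtain ⟨haW, ha'⟩ := Finset.mem_inter.1 ha
  have hav := (mem_inN.1 ha').2
  refine absurd (hmin a haW) (not_le.2 (Finset.card_lt_card ?_))
  refine ⟨fun b hb => ?_, fun h => ?_⟩
  · simp only [Finset.mem_inter, mem_inN] at hb ⊢
    exact ⟨hb.1, hb.2.1, (mem_maxTrans.1 hW).2.1 b hb.1 a haW v hv hb.2.2 hav⟩
  · exact hT.irrefl a (mem_inN.1 (Finset.mem_inter.1 (h ha)).2).2

theorem BoundedBelow.of_three_le_inN (hT : T.IsTournament) {S : Finset V}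
    (hS : T.BoundedBelow S) (hne : S.Nonempty) (h3 : ∀ v ∈ S, 3 ≤ (T.inN S v).card) :
    ((T.maxTrans S).card : ℝ) ≤ (837 / 500) ^ S.card := by
  rw [← cnt_true]
  refine (cnt_le_sum S (fun v W => v ∈ W ∧ W ∩ T.inN S v = ∅ ∧ Disjoint W ∅) ?_).trans ?_
  · intro W hW _
    obtain ⟨v, hv, h⟩ := exists_source hT hW hne
    exact ⟨v, (mem_maxTrans.1 hW).1 hv, hv, h, by simp⟩
  · refine (Finset.sum_le_sum fun v hv => hS.cnt_le hT v ∅ ∅ (fun W _ h => h) v hv (by simp) ∅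
      (by simp) (T.inN S v).card (by simp)).trans ?_
    simp_rw [pow_succ (500 / 837 : ℝ), ← mul_assoc]
    rw [← Finset.sum_mul, ← Finset.mul_sum, mul_assoc]
    refine mul_le_of_le_one_right (by positivity) ?_
    have := sum_pow_le_of_landau (fun U hU => landau hT (S := S) hU) h3
    linarith

theorem card_maxTrans_le (hT : T.IsTournament) (S : Finset V) :
    ((T.maxTrans S).card : ℝ) ≤ (837 / 500) ^ S.card := by
  induction hn : S.card using Nat.strong_induction_on generalizing S with
  | _ n ih =>
  subst hn
  have hS : T.BoundedBelow S := fun D hD => ih D.card hD D rfl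
  rcases S.eq_empty_or_nonempty with rfl | hne
  · have : T.maxTrans ∅ ⊆ {∅} := fun W hW =>
      Finset.mem_singleton.2 (Finset.subset_empty.1 (mem_maxTrans.1 hW).1)
    simpa using Finset.card_le_card this
  by_cases h0 : ∃ v ∈ S, (T.inN S v).card = 0
  · obtain ⟨v, hv, h⟩ := h0
    exact hS.of_inN_eq_empty hT hv (Finset.card_eq_zero.1 h)
  by_cases h1 : ∃ v ∈ S, (T.inN S v).card = 1
  · obtain ⟨v, hv, h⟩ := h1
    obtain ⟨u, hu⟩ := Finset.card_eq_one.1 h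
    exact hS.of_inN_eq_singleton hT hv hu
  push Not at h0 h1
  have hdeg : ∀ w ∈ S, 2 ≤ (T.inN S w).card := fun w hw => by
    have := h0 w hw
    have := h1 w hw
    omega
  by_cases h2 : ∃ v ∈ S, (T.inN S v).card = 2
  · obtain ⟨v, hv, h⟩ := h2
    obtain ⟨u₁, u₂, hu, h12⟩ := exists_eq_pair_of_card_eq_two hT h
    have hu1 := hdeg u₁ (mem_inN.1 (by rw [hu]; simp : u₁ ∈ T.inN S v)).1
    have hu2 := hdeg u₂ (mem_inN.1 (by rw [hu]; simp : u₂ ∈ T.inN S v)).1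
    by_cases hl : 4 ≤ (T.inN S u₁).card ∨ 4 ≤ (T.inN S u₂).card ∨
        3 ≤ (T.inN S u₁).card ∧ 3 ≤ (T.inN S u₂).card
    · exact hS.of_inN_eq_pair_of_large hT hv hu h12 hu1 hu2 hl
    by_cases h22 : (T.inN S u₂).card = 2
    · exact hS.of_inN_eq_pair_of_card_eq_two hT hv hu h12 (by omega) h22
    · exact hS.of_inN_eq_pair_of_two_three hT hv hu h12 (by omega) (by omega) hdeg
  push Not at h2
  refine hS.of_three_le_inN hT hne fun v hv => ?_
  have := hdeg v hv
  have := h2 v hv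
  omega

/-! ### Feedback vertex sets as complements of transitive sets -/

theorem acyclic_inducedOn_iff (hT : T.IsTournament) (W : Finset V) :
    (T.inducedOn (W : Set V)).Acyclic ↔ T.IsTransOn W := by
  constructor
  · intro h a ha b hb c hc hab hbc
    have hne : a ≠ c := fun e => hT.asymm hab (e ▸ hbc)
    refine (hT.total hne).resolve_right fun hca => h ⟨a, ha⟩ ?_
    have h1 : (T.inducedOn (W : Set V)).Adj ⟨a, ha⟩ ⟨b, hb⟩ := hab
    have h2 : (T.inducedOn (W : Set V)).Adj ⟨b, hb⟩ ⟨c, hc⟩ := hbc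
    have h3 : (T.inducedOn (W : Set V)).Adj ⟨c, hc⟩ ⟨a, ha⟩ := hca
    exact ((Relation.TransGen.single h1).tail h2).tail h3
  · intro h v hv
    have key : ∀ w, Relation.TransGen (T.inducedOn (W : Set V)).Adj v w → T.Adj v w := by
      intro w hw
      induction hw with
      | single h => exact h
      | tail _ hbc ih => exact h _ v.2 _ (Subtype.coe_prop _) _ (Subtype.coe_prop _) ih hbc
    exact hT.irrefl _ (key v hv)

theorem mem_maxTrans_univ_iff [Fintype V] (hT : T.IsTournament) (W : Finset V) :
    W ∈ T.maxTrans Finset.univ ↔ ((W : Set V)ᶜ) ∈ T.minimalFVS := by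
  have key : ∀ W : Finset V, T.IsFVS ((W : Set V)ᶜ) ↔ T.IsTransOn W := fun W => by
    rw [IsFVS, compl_compl, acyclic_inducedOn_iff hT]
  rw [mem_maxTrans, minimalFVS, Set.mem_ofPred_eq, Minimal, key]
  constructor
  · rintro ⟨-, htr, hmax⟩
    refine ⟨htr, fun F hF hle x hx => by_contra fun hxF => hx ?_⟩
    rw [← compl_compl F, ← Set.coe_toFinset Fᶜ, key] at hF
    refine hmax x (Finset.mem_univ x) (hF.mono (Finset.insert_subset ?_ fun y hy => ?_))
    · simpa using hxF
    · simp only [Set.mem_toFinset]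
      exact fun hyF => hle hyF hy
  · rintro ⟨htr, hmin⟩
    refine ⟨Finset.subset_univ _, htr, fun x _ hx => ?_⟩
    have := hmin ((key _).2 hx) (Set.compl_subset_compl.2 (by simp))
    by_contra hxW
    exact this hxW (by simp)

theorem numMinimalFVS_eq [Fintype V] (hT : T.IsTournament) :
    T.numMinimalFVS = (T.maxTrans Finset.univ).card := by
  rw [numMinimalFVS, ← Set.ncard_coe_finset]
  symm
  refine Set.ncard_congr (fun W _ => ((W : Set V)ᶜ)) ?_ ?_ ?_
  · intro W hW
    exact (mem_maxTrans_univ_iff hT W).1 hW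
  · intro W W' _ _ h
    exact_mod_cast compl_injective h
  · intro F hF
    have e : ((Fᶜ.toFinset : Finset V) : Set V)ᶜ = F := by simp
    exact ⟨Fᶜ.toFinset, (mem_maxTrans_univ_iff hT _).2 (by rwa [e]), e⟩

/-! ### Relabelling, ordered sums and the Paley tournament -/

/-- Transport of a digraph along an equivalence of vertex sets. -/
def relabel {V' : Type*} (T : Digraph V) (e : V ≃ V') : Digraph V' where
  Adj a b := T.Adj (e.symm a) (e.symm b)

theorem IsTournament.relabel {V' : Type*} (hT : T.IsTournament) (e : V ≃ V') :
    (T.relabel e).IsTournament :=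
  ⟨fun _ => hT.1 _, fun _ _ h => hT.2 _ _ fun h' => h (e.symm.injective h')⟩

theorem isTransOn_relabel_map {V' : Type*} (e : V ≃ V') (W : Finset V) :
    (T.relabel e).IsTransOn (W.map e.toEmbedding) ↔ T.IsTransOn W := by
  simp only [IsTransOn, Finset.forall_mem_map, relabel, Equiv.coe_toEmbedding,
    Equiv.symm_apply_apply]

theorem card_maxTrans_le_relabel {V' : Type*} [Fintype V] [Fintype V'] (T : Digraph V)
    (e : V ≃ V') :
    (T.maxTrans Finset.univ).card ≤ ((T.relabel e).maxTrans Finset.univ).card := by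
  refine Finset.card_le_card_of_injOn (fun W => W.map e.toEmbedding) ?_
    (Finset.map_injective _).injOn
  intro W hW
  obtain ⟨-, htr, hmax⟩ := mem_maxTrans.1 hW
  refine mem_maxTrans.2 ⟨Finset.subset_univ _, (isTransOn_relabel_map e W).2 htr, fun x _ hx => ?_⟩
  obtain ⟨x, rfl⟩ := e.surjective x
  refine Finset.mem_map_of_mem _ (hmax x (Finset.mem_univ x) ?_)
  rw [← isTransOn_relabel_map e, Finset.map_insert]
  exact hx

theorem card_maxTrans_le_maxMinimalFVS [Fintype V] (hT : T.IsTournament) {n : ℕ}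
    (hn : Fintype.card V = n) : (T.maxTrans Finset.univ).card ≤ maxMinimalFVS n := by
  let e := Fintype.equivFinOfCardEq hn
  refine (card_maxTrans_le_relabel T e).trans ?_
  refine (isGreatest_maxMinimalFVS n).2 ⟨T.relabel e, hT.relabel e, ?_⟩
  rw [numMinimalFVS_eq (hT.relabel e)]

/-- The disjoint union of two digraphs with all arcs from the first to the second. -/
def ordSum {V' : Type*} (T : Digraph V) (T' : Digraph V') : Digraph (V ⊕ V') where
  Adj := Sum.Lex T.Adj T'.Adj

theorem IsTournament.ordSum {V' : Type*} {T' : Digraph V'} (hT : T.IsTournament)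
    (hT' : T'.IsTournament) : (T.ordSum T').IsTournament := by
  constructor
  · rintro (v | v) h
    · exact hT.1 v (Sum.lex_inl_inl.1 h)
    · exact hT'.1 v (Sum.lex_inr_inr.1 h)
  · rintro (u | u) (v | v) h
    · simpa [Digraph.ordSum] using hT.2 u v fun e => h (e ▸ rfl)
    · simp [Digraph.ordSum, Xor]
    · simp [Digraph.ordSum, Xor]
    · simpa [Digraph.ordSum] using hT'.2 u v fun e => h (e ▸ rfl)

theorem isTransOn_ordSum_disjSum {V' : Type*} {T' : Digraph V'} (W : Finset V) (W' : Finset V') :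
    (T.ordSum T').IsTransOn (W.disjSum W') ↔ T.IsTransOn W ∧ T'.IsTransOn W' := by
  constructor
  · intro h
    constructor
    · intro a ha b hb c hc hab hbc
      exact Sum.lex_inl_inl.1 (h (Sum.inl a) (Finset.inl_mem_disjSum.2 ha) (Sum.inl b)
        (Finset.inl_mem_disjSum.2 hb) (Sum.inl c) (Finset.inl_mem_disjSum.2 hc)
        (Sum.Lex.inl hab) (Sum.Lex.inl hbc))
    · intro a ha b hb c hc hab hbc
      exact Sum.lex_inr_inr.1 (h (Sum.inr a) (Finset.inr_mem_disjSum.2 ha) (Sum.inr b)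
        (Finset.inr_mem_disjSum.2 hb) (Sum.inr c) (Finset.inr_mem_disjSum.2 hc)
        (Sum.Lex.inr hab) (Sum.Lex.inr hbc))
  · rintro ⟨h, h'⟩ (a | a) ha (b | b) hb (c | c) hc hab hbc <;>
      simp only [ordSum, Sum.lex_inl_inl, Sum.lex_inr_inr, Sum.Lex.sep, Sum.lex_inr_inl,
        Finset.inl_mem_disjSum, Finset.inr_mem_disjSum] at *
    · exact h a ha b hb c hc hab hbc
    · exact h' a ha b hb c hc hab hbc

/-- Transitivity in an ordered sum is tested on each side separately, so pairs of maximal transitive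
sets give maximal ones. -/
theorem card_maxTrans_mul_le_ordSum {V' : Type*} [Fintype V] [Fintype V'] (T : Digraph V)
    (T' : Digraph V') : (T.maxTrans Finset.univ).card * (T'.maxTrans Finset.univ).card ≤
      ((T.ordSum T').maxTrans Finset.univ).card := by
  rw [← Finset.card_product]
  refine Finset.card_le_card_of_injOn (fun W => W.1.disjSum W.2) ?_ ?_
  · rintro ⟨W, W'⟩ hW
    obtain ⟨hW, hW'⟩ := Finset.mem_product.1 hW
    obtain ⟨-, htr, hmax⟩ := mem_maxTrans.1 hW
    obtain ⟨-, htr', hmax'⟩ := mem_maxTrans.1 hW'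
    refine mem_maxTrans.2 ⟨Finset.subset_univ _, (isTransOn_ordSum_disjSum W W').2 ⟨htr, htr'⟩, ?_⟩
    rintro (x | x) _ hx
    · have h2 : (T.ordSum T').IsTransOn ((insert x W).disjSum W') :=
        hx.mono (by rintro (y | y) <;> simp)
      simpa using hmax x (Finset.mem_univ x) ((isTransOn_ordSum_disjSum _ _).1 h2).1
    · have h2 : (T.ordSum T').IsTransOn (W.disjSum (insert x W')) :=
        hx.mono (by rintro (y | y) <;> simp)
      simpa using hmax' x (Finset.mem_univ x) ((isTransOn_ordSum_disjSum _ _).1 h2).2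
  · rintro ⟨W₁, W₂⟩ _ ⟨W₁', W₂'⟩ _ h
    have h : W₁.disjSum W₂ = W₁'.disjSum W₂' := h
    have h1 : W₁ = W₁' := by
      ext y; rw [← Finset.inl_mem_disjSum (t := W₂), h, Finset.inl_mem_disjSum]
    have h2 : W₂ = W₂' := by
      ext y; rw [← Finset.inr_mem_disjSum (s := W₁), h, Finset.inr_mem_disjSum]
    rw [h1, h2]

theorem isTournament_lt {α : Type*} [LinearOrder α] :
    (⟨fun u v => u < v⟩ : Digraph α).IsTournament :=
  ⟨fun v => lt_irrefl v, fun _ _ h => (lt_or_gt_of_ne h).imp (fun h => ⟨h, h.not_gt⟩)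
    fun h => ⟨h, h.not_gt⟩⟩

/-- The quadratic residue tournament on seven vertices. -/
def paleySeven : Digraph (Fin 7) where
  Adj u v := v - u = 1 ∨ v - u = 2 ∨ v - u = 4

theorem isTournament_paleySeven : paleySeven.IsTournament := by
  constructor
  · intro v; simp only [paleySeven]; revert v; decide
  · intro u v; simp only [paleySeven]; revert u v; decide

end Digraph

/-! ### Bounds on `M(n)` and the limit -/

theorem exists_tournament_maxMinimalFVS (n : ℕ) : ∃ T : Digraph (Fin n), T.IsTournament ∧
    (T.maxTrans Finset.univ).card = maxMinimalFVS n := by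
  obtain ⟨T, hT, h⟩ := (isGreatest_maxMinimalFVS n).1
  exact ⟨T, hT, by rw [← h, Digraph.numMinimalFVS_eq hT]⟩

theorem maxMinimalFVS_mul_le (m n : ℕ) :
    maxMinimalFVS m * maxMinimalFVS n ≤ maxMinimalFVS (m + n) := by
  obtain ⟨T, hT, h⟩ := exists_tournament_maxMinimalFVS m
  obtain ⟨T', hT', h'⟩ := exists_tournament_maxMinimalFVS n
  rw [← h, ← h']
  exact (Digraph.card_maxTrans_mul_le_ordSum T T').trans
    (Digraph.card_maxTrans_le_maxMinimalFVS (hT.ordSum hT') (by simp))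

theorem maxMinimalFVS_le (n : ℕ) : (maxMinimalFVS n : ℝ) ≤ (837 / 500) ^ n := by
  obtain ⟨T, hT, h⟩ := exists_tournament_maxMinimalFVS n
  rw [← h]
  simpa using Digraph.card_maxTrans_le hT Finset.univ

theorem maxMinimalFVS_pos (n : ℕ) : 0 < maxMinimalFVS n := by
  refine lt_of_lt_of_le (Finset.card_pos.2 ⟨Finset.univ, ?_⟩)
    (Digraph.card_maxTrans_le_maxMinimalFVS (V := Fin n) Digraph.isTournament_lt (by simp))
  exact Digraph.mem_maxTrans.2 ⟨subset_rfl, fun a _ b _ c _ => lt_trans,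
    fun x hx _ => hx⟩

theorem twentyOne_le_maxMinimalFVS_seven : 21 ≤ maxMinimalFVS 7 := by
  refine le_trans ?_ (Digraph.card_maxTrans_le_maxMinimalFVS Digraph.isTournament_paleySeven
    (by simp))
  let I : Finset (Fin 7 × Fin 7) := Finset.univ ×ˢ {1, 2, 4}
  -- For a residue `d ∈ {1, 2, 4}` also `2 * d` is a residue, so `a, a + d, a + 2 * d` is a
  -- transitive triple; there are `7 * 3` of them.
  let f : Fin 7 × Fin 7 → Finset (Fin 7) := fun p => {p.1, p.1 + p.2, p.1 + 2 * p.2}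
  have hI : I.card = 21 := by decide
  rw [← hI]
  refine Finset.card_le_card_of_injOn f (fun p hp => ?_) ?_
  · refine Digraph.mem_maxTrans.2 ⟨Finset.subset_univ _, ?_, fun x _ hx => ?_⟩
    · have : ∀ p ∈ I, ∀ a ∈ f p, ∀ b ∈ f p, ∀ c ∈ f p, (b - a = 1 ∨ b - a = 2 ∨ b - a = 4) →
        (c - b = 1 ∨ c - b = 2 ∨ c - b = 4) → (c - a = 1 ∨ c - a = 2 ∨ c - a = 4) := by decide
      exact this p hp
    · have : ∀ p ∈ I, ∀ x : Fin 7, (∀ a ∈ insert x (f p), ∀ b ∈ insert x (f p),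
        ∀ c ∈ insert x (f p), (b - a = 1 ∨ b - a = 2 ∨ b - a = 4) →
        (c - b = 1 ∨ c - b = 2 ∨ c - b = 4) → (c - a = 1 ∨ c - a = 2 ∨ c - a = 4)) →
        x ∈ f p := by decide
      refine this p hp x fun a ha b hb c hc => hx a ?_ b ?_ c ?_
      · simpa using ha
      · simpa using hb
      · simpa using hc
  · have : ∀ p ∈ I, ∀ q ∈ I, f p = f q → p = q := by decide
    exact fun p hp q hq h => this p hp q hq h

theorem mainTheorem5 :
    ∃ L : ℝ, Tendsto (fun n : ℕ => (maxMinimalFVS n : ℝ) ^ (1 / (n : ℝ))) atTop (𝓝 L) ∧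
      (1.5448 : ℝ) ≤ L ∧ L ≤ (1.6740 : ℝ) := by
  have hpos : ∀ n, (0 : ℝ) < maxMinimalFVS n := fun n => by exact_mod_cast maxMinimalFVS_pos n
  -- Fekete's lemma is stated for subadditive sequences, hence the sign; its limit is an infimum, so
  -- the single value `n = 7` bounds `L` from below.
  have hsub : Subadditive fun n => -Real.log (maxMinimalFVS n) := fun m n => by
    rw [← neg_add, neg_le_neg_iff, ← Real.log_mul (hpos m).ne' (hpos n).ne']
    exact Real.log_le_log (mul_pos (hpos m) (hpos n)) (by exact_mod_cast maxMinimalFVS_mul_le m n)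
  have hup : ∀ n : ℕ, Real.log (maxMinimalFVS n) / n ≤ Real.log (837 / 500) := fun n => by
    rcases n.eq_zero_or_pos with rfl | hn
    · simpa using Real.log_nonneg (by norm_num)
    · rw [div_le_iff₀ (by exact_mod_cast hn), mul_comm, ← Real.log_pow]
      exact Real.log_le_log (hpos n) (maxMinimalFVS_le n)
  have hbdd : BddBelow (Set.range fun n : ℕ => -Real.log (maxMinimalFVS n) / n) := by
    refine ⟨-Real.log (837 / 500), ?_⟩
    rintro _ ⟨n, rfl⟩
    have := hup n
    simp only [neg_div]
    linarith
  have hlim := hsub.tendsto_lim hbdd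
  have hlim' : Tendsto (fun n : ℕ => Real.log (maxMinimalFVS n) / n) atTop (𝓝 (-hsub.lim)) := by
    refine hlim.neg.congr fun n => ?_
    rw [neg_div, neg_neg]
  refine ⟨Real.exp (-hsub.lim), ?_, ?_, ?_⟩
  · refine ((Real.continuous_exp.tendsto _).comp hlim').congr fun n => ?_
    rw [Function.comp_apply, Real.rpow_def_of_pos (hpos n), mul_one_div]
  · have h7 := hsub.lim_le_div hbdd (n := 7) (by norm_num)
    have h21 : Real.log (1.5448 ^ 7) ≤ Real.log (maxMinimalFVS 7) := by
      refine Real.log_le_log (by norm_num) (le_trans ?_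
        (by exact_mod_cast twentyOne_le_maxMinimalFVS_seven : (21 : ℝ) ≤ maxMinimalFVS 7))
      norm_num
    rw [Real.log_pow] at h21
    rw [← Real.log_le_iff_le_exp (by norm_num)]
    push_cast at h7 h21
    linarith
  · rw [← Real.le_log_iff_exp_le (by norm_num)]
    refine le_of_tendsto' hlim' fun n => (hup n).trans (le_of_eq ?_)
    norm_num
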